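/- **Theorem (pure Price of Anarchy at most $6$).** *Model.* There are finitely many advertisers $i$ and finitely many rich ads $j$. Publicly known are the total space $W>0$, the spaces $w_{ij}\in(0,W]$ and the click probabilities $\alpha_{ij}\in[0,1]$. Advertiser $i$ has a true type $(v_i,A_i)$, a value per click $v_i\ge 0$ and a set $A_i$ of rich ads, and reports $(b_i,S_i)$ with $b_i\ge 0$ and $S_i\subseteq A_i$. Put $v_{ij}=\alpha_{ij}v_i$ for $j\in A_i$ and $v_{ij}=0$ otherwise; put $b_{ij}=\alpha_{ij}b_i$ for $j\in S_i$ and $b_{ij}=0$ otherwise. The welfare of an allocation $x=(x_{ij})$ is $SW(x)=\sum_{i,j}x_{ij}v_{ij}$. $SW(\mathrm{IntOPT}(\mathbf v,\mathbf A))$ is the maximum of $SW(x)$ over integral allocations $x_{ij}\in\{0,1\}$ with $\sum_j x_{ij}\le 1$ for every $i$ and $\sum_{i,j}w_{ij}x_{ij}\le W$. *Allocation rules* (ties are broken by an arbitrary rule). - $ALG_B$ starts with remaining space $w=W$, no allocated ads, and available sets $E_i=S_i$. While $w>0$ and some ad is available, it takes an available ad $(i,j)$ of maximum bang-per-buck $b_{ij}/w_{ij}$.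 Let $w_{ik}$ be the space of the ad currently allocated to $i$ ($0$ if there is none). All ads of $i$ of space at most $w_{ij}$ are removed from $E_i$. If $w\ge w_{ij}-w_{ik}$, then $j$ replaces $k$ and $w$ decreases by $w_{ij}-w_{ik}$. Otherwise $j$ replaces $k$ fractionally, with weight $(w_{ik}+w)/w_{ij}$, and $w$ becomes $0$. Let $W_i$ be the space given to $i$ in the end. - $ALG_I$ gives every advertiser $i$ an ad $j\in S_i$ with $w_{ij}\le W_i$ of maximum $b_{ij}$ (nothing if there is no such ad). - $ALG_{\max}$ allocates only one ad, a reported ad $(i,j)$, $j\in S_i$, of maximum $b_{ij}$ (nothing if no ad is reported). *Payments and mechanism.* For an allocation rule $x$ let $x_i(\mathbf b,\mathbf S)=\sum_{j\in S_i}x_{ij}(\mathbf b,\mathbf S)\,\alpha_{ij}$ be the number of expected clicks. The GSP price per click is $$cpc_i(\mathbf b,\mathbf S)=\inf\{b_i'\ge 0 : x_i(b_i',\mathbf b_{-i},\mathbf S)=x_i(\mathbf b,\mathbf S)\},$$ the GSP payment is $x_i(\mathbf b,\mathbf S)\,cpc_i(\mathbf b,\mathbf S)$, and the utility of $i$ is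 $x_i(\mathbf b,\mathbf S)\,(v_i-cpc_i(\mathbf b,\mathbf S))$. The mechanism $\mathcal M$ runs $ALG_I$ with probability $1/2$ and $ALG_{\max}$ with probability $1/2$, and charges the GSP payments of the rule that is run. The utility $u_i$ and the welfare $SW(\mathcal M(\mathbf b,\mathbf S))$ are expectations over this coin flip. *Equilibria.* A report profile $(\mathbf b,\mathbf S)$ is a pure Nash equilibrium for $(\mathbf v,\mathbf A)$ if no advertiser $i$ can increase $u_i$ by reporting another $(b_i',S_i')$ with $b_i'\ge 0$ and $S_i'\subseteq A_i$. It satisfies no overbidding if $b_i\le v_i$ for all $i$. *Claim.* For all types $(\mathbf v,\mathbf A)$ and every pure Nash equilibrium $(\mathbf b,\mathbf S)$ that satisfies no overbidding, $$SW(\mathcal M(\mathbf b,\mathbf S))\ \ge\ \tfrac16\,SW(\mathrm{IntOPT}(\mathbf v,\mathbf A)).$$ Equivalently, the pure Price of Anarchy of $\mathcal M$ under no overbidding, that is, the supremum of $SW(\mathrm{IntOPT}(\mathbf v,\mathbf A))/SW(\mathcal M(\mathbf b,\mathbf S))$ over all such types and equilibria (with $0/0=0$ and $a/0=\infty$ for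 $a>0$), is at most $6$. -/

import Mathlib

namespace RichAds

/-- The public data of a rich-ad auction with advertisers `ι` and rich ads `S`: the space `space i j`
and the click probability `ctr i j` of ad `j` for advertiser `i`, and the total space `W`. -/
structure Market (ι S : Type*) where
  space : ι → S → ℝ
  ctr : ι → S → ℝ
  W : ℝ
  W_pos : 0 < W
  space_pos : ∀ i j, 0 < space i j
  space_le : ∀ i j, space i j ≤ W
  ctr_nonneg : ∀ i j, 0 ≤ ctr i j
  ctr_le_one : ∀ i j, ctr i j ≤ 1

/-- For every advertiser a number per click and a set of rich ads. It serves both for the true types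
`(v, A)` and for the reports `(b, S)`. -/
structure Profile (ι S : Type*) where
  perClick : ι → ℝ
  ads : ι → Finset S

/-- The profile in which advertiser `i` reports `(b', S')` and the others report as in `P`. -/
def Profile.deviate {ι S : Type*} [DecidableEq ι] (P : Profile ι S) (i : ι) (b' : ℝ)
    (S' : Finset S) : Profile ι S where
  perClick := Function.update P.perClick i b'
  ads := Function.update P.ads i S'

/-- A (possibly randomized or fractional) allocation: `x i j` is the weight of ad `j` for `i`. -/
abbrev Allocation (ι S : Type*) := ι → S → ℝ

/-- An element of `E` at which `f` is maximal; among several maximizers one of the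
highest priority is taken. -/
noncomputable def pickMax {T : Type*} (E : Finset T) (hE : E.Nonempty) (f : T → ℝ)
    (priority : T → ℕ) : T :=
  (E.exists_max_image (fun a => toLex (f a, priority a)) hE).choose

/-- An arbitrary tie-breaking rule, which may depend on the reports: priorities of the ads in the
bang-per-buck order, in the post-processing, and in the choice of an ad of maximum value. -/
structure TieBreaking (ι S : Type*) where
  order : Profile ι S → ι × S → ℕ
  post : Profile ι S → ι × S → ℕ
  maxValue : Profile ι S → ι × S → ℕ

namespace Market

variable {ι S : Type*} [Fintype ι] [Fintype S] [DecidableEq S]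

/-- `b i j = b i * α i j` if ad `j` is in the set of advertiser `i`, and `0` otherwise. For true
types this is the value `v i j`. -/
noncomputable def adValue (M : Market ι S) (P : Profile ι S) (i : ι) (j : S) : ℝ :=
  if j ∈ P.ads i then P.perClick i * M.ctr i j else 0

/-- Social welfare of an allocation with respect to the true types `θ`. -/
noncomputable def welfare (M : Market ι S) (θ : Profile ι S) (x : Allocation ι S) : ℝ :=
  ∑ i, ∑ j, x i j * M.adValue θ i j

/-- Feasible integral allocations. -/
def IsIntegralFeasible (M : Market ι S) (x : Allocation ι S) : Prop :=
  (∀ i j, x i j = 0 ∨ x i j = 1) ∧ (∀ i, ∑ j, x i j ≤ 1) ∧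
    ∑ i, ∑ j, x i j * M.space i j ≤ M.W

/-- The optimal integral welfare `SW(IntOPT)`. -/
noncomputable def intOpt (M : Market ι S) (θ : Profile ι S) : ℝ :=
  sSup (M.welfare θ '' {x | M.IsIntegralFeasible x})

/-- The supremum in `intOpt` is a maximum. -/
theorem isGreatest_intOpt (M : Market ι S) (θ : Profile ι S) :
    IsGreatest (M.welfare θ '' {x | M.IsIntegralFeasible x}) (M.intOpt θ) := by
  have hfin : {x : Allocation ι S | M.IsIntegralFeasible x}.Finite := by
    refine Set.Finite.subset (Set.Finite.pi' (t := fun _ : ι => {y : S → ℝ | ∀ j, y j ∈ ({0, 1} : Set ℝ)})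
      (fun _ => Set.Finite.pi' (fun _ => by simp))) ?_
    intro x hx i j
    simpa using hx.1 i j
  have hne : {x : Allocation ι S | M.IsIntegralFeasible x}.Nonempty :=
    ⟨fun _ _ => 0, by simp [IsIntegralFeasible, M.W_pos.le]⟩
  exact ⟨(hne.image _).csSup_mem (hfin.image _), fun a ha => le_csSup (hfin.image _).bddAbove ha⟩

variable [DecidableEq ι]

/-! ### The space allocation algorithm -/

/-- A stage of the algorithm: the ads still available, the remaining space, and the current
fractional allocation. -/
structure Stage (ι S : Type*) where
  avail : Finset (ι × S)
  rem : ℝ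
  alloc : Allocation ι S

/-- The space `W i` that an allocation gives to advertiser `i`. -/
noncomputable def spaceOf (M : Market ι S) (x : Allocation ι S) (i : ι) : ℝ :=
  ∑ j, M.space i j * x i j

/-- Bang-per-buck of an ad under the reports `P`. -/
noncomputable def bangPerBuck (M : Market ι S) (P : Profile ι S) (a : ι × S) : ℝ :=
  M.adValue P a.1 a.2 / M.space a.1 a.2

/-- Processing ad `j` of advertiser `i`. The space `M.spaceOf s.alloc i` held so far by `i` is the
space of the ad previously allocated to `i` (zero if there is none), which is replaced by `j`. -/
noncomputable def processAd (M : Market ι S) (s : Stage ι S) (i : ι) (j : S) : Stage ι S :=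
  let held := M.spaceOf s.alloc i
  let avail' := s.avail.filter (fun a => ¬ (a.1 = i ∧ M.space i a.2 ≤ M.space i j))
  if M.space i j - held ≤ s.rem then
    { avail := avail'
      rem := s.rem - (M.space i j - held)
      alloc := Function.update s.alloc i (Pi.single j 1) }
  else
    { avail := avail'
      rem := 0
      alloc := Function.update s.alloc i (Pi.single j ((held + s.rem) / M.space i j)) }

/-- One round of the loop: as long as there is remaining space and an available ad, process an
available ad of highest bang-per-buck; otherwise nothing changes any more. -/
noncomputable def nextStage (M : Market ι S) (P : Profile ι S) (priority : ι × S → ℕ)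
    (s : Stage ι S) : Stage ι S :=
  if h : s.rem ≠ 0 ∧ s.avail.Nonempty then
    let a := pickMax s.avail h.2 (M.bangPerBuck P) priority
    M.processAd s a.1 a.2
  else s

/-- Initially all reported ads are available, all space is free, and nothing is allocated. -/
def initialStage (M : Market ι S) (P : Profile ι S) : Stage ι S where
  avail := Finset.univ.filter (fun a : ι × S => a.2 ∈ P.ads a.1)
  rem := M.W
  alloc := fun _ _ => 0

/-- The last stage of `ALG_B`. Every round that changes the stage uses up an available ad, so after
as many rounds as there are reported ads the loop has ended (see `algB_halted`). -/
noncomputable def algB (M : Market ι S) (P : Profile ι S) (priority : ι × S → ℕ) : Stage ι S :=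
  (M.nextStage P priority)^[(M.initialStage P).avail.card] (M.initialStage P)

theorem algB_halted (M : Market ι S) (P : Profile ι S) (priority : ι × S → ℕ) :
    ¬ ((M.algB P priority).rem ≠ 0 ∧ (M.algB P priority).avail.Nonempty) := by
  have hstep : ∀ s : Stage ι S, (s.rem ≠ 0 ∧ s.avail.Nonempty) →
      (M.nextStage P priority s).avail.card < s.avail.card := by
    intro s h
    have hav : (M.nextStage P priority s).avail = s.avail.filter (fun a =>
        ¬ (a.1 = (pickMax s.avail h.2 (M.bangPerBuck P) priority).1 ∧
          M.space (pickMax s.avail h.2 (M.bangPerBuck P) priority).1 a.2 ≤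
          M.space (pickMax s.avail h.2 (M.bangPerBuck P) priority).1
            (pickMax s.avail h.2 (M.bangPerBuck P) priority).2)) := by
      simp only [nextStage, dif_pos h, processAd]
      split_ifs <;> rfl
    rw [hav]
    apply Finset.card_lt_card
    rw [Finset.filter_ssubset]
    exact ⟨pickMax s.avail h.2 (M.bangPerBuck P) priority,
      (s.avail.exists_max_image _ h.2).choose_spec.1, by simp⟩
  have key : ∀ (n : ℕ) (s : Stage ι S), s.avail.card ≤ n →
      ¬ (((M.nextStage P priority)^[n] s).rem ≠ 0 ∧ ((M.nextStage P priority)^[n] s).avail.Nonempty) := by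
    intro n
    induction n with
    | zero =>
      intro s hs h
      have := Finset.card_pos.mpr h.2
      simp only [Function.iterate_zero, id_eq] at this
      omega
    | succ n ih =>
      intro s hs
      rw [Function.iterate_succ_apply]
      by_cases h : s.rem ≠ 0 ∧ s.avail.Nonempty
      · exact ih _ (by have := hstep s h; omega)
      · have hfix : M.nextStage P priority s = s := by simp only [nextStage, dif_neg h]
        rw [hfix, Function.iterate_fixed hfix]
        exact h
  exact key _ _ le_rfl

/-! ### The two integral allocation rules -/

/-- `ALG_I`: every advertiser gets a reported ad of maximum reported value among those that fit in
the space allotted by `ALG_B`. -/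
noncomputable def algI (M : Market ι S) (t : TieBreaking ι S) (P : Profile ι S) :
    Allocation ι S := fun i =>
  let fits := (P.ads i).filter
    (fun j => M.space i j ≤ M.spaceOf (M.algB P (t.order P)).alloc i)
  if h : fits.Nonempty then
    Pi.single (pickMax fits h (M.adValue P i) (fun j => t.post P (i, j))) 1
  else 0

/-- Only a reported ad of maximum reported value is allocated. -/
noncomputable def algMax (M : Market ι S) (t : TieBreaking ι S) (P : Profile ι S) :
    Allocation ι S :=
  let reported := Finset.univ.filter (fun a : ι × S => a.2 ∈ P.ads a.1)
  if h : reported.Nonempty then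
    let a := pickMax reported h (fun a => M.adValue P a.1 a.2) (t.maxValue P)
    Pi.single a.1 (Pi.single a.2 1)
  else 0

/-! ### GSP prices, the mechanism, and equilibria -/

/-- The expected number of clicks `x i (b, S)` under an allocation rule. -/
noncomputable def clicks (M : Market ι S) (rule : Profile ι S → Allocation ι S)
    (P : Profile ι S) (i : ι) : ℝ :=
  ∑ j ∈ P.ads i, rule P i j * M.ctr i j

/-- GSP price per click: the infimum of the bids at which `i` gets the same number of clicks. -/
noncomputable def gspPrice (M : Market ι S) (rule : Profile ι S → Allocation ι S)
    (P : Profile ι S) (i : ι) : ℝ :=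
  sInf {b' : ℝ | 0 ≤ b' ∧ M.clicks rule (P.deviate i b' (P.ads i)) i = M.clicks rule P i}

/-- Quasi-linear utility, at value per click `v`, of advertiser `i` under an allocation rule with
GSP payments. -/
noncomputable def gspUtility (M : Market ι S) (rule : Profile ι S → Allocation ι S)
    (v : ℝ) (P : Profile ι S) (i : ι) : ℝ :=
  v * M.clicks rule P i - M.clicks rule P i * M.gspPrice rule P i

/-- Allocation of the mechanism that runs each of the two rules with probability `1/2`. -/
noncomputable def mechAlloc (M : Market ι S) (t : TieBreaking ι S) (P : Profile ι S) :
    Allocation ι S :=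
  fun i j => (1 / 2) * M.algI t P i j + (1 / 2) * M.algMax t P i j

/-- Expected utility in the mechanism, where the GSP payment of the rule selected by the coin flip
is charged. -/
noncomputable def mechUtility (M : Market ι S) (t : TieBreaking ι S) (v : ℝ)
    (P : Profile ι S) (i : ι) : ℝ :=
  (1 / 2) * M.gspUtility (M.algI t) v P i + (1 / 2) * M.gspUtility (M.algMax t) v P i

/-- `(b, S)` is a pure Nash equilibrium for the true types `(v, A)`. Bids are nonnegative, and only
subsets of the true set of ads can be reported. -/
def IsPureNash (M : Market ι S) (t : TieBreaking ι S) (θ P : Profile ι S) : Prop :=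
  (∀ i, 0 ≤ P.perClick i ∧ P.ads i ⊆ θ.ads i) ∧
    ∀ (i : ι) (b' : ℝ) (S' : Finset S), 0 ≤ b' → S' ⊆ θ.ads i →
      M.mechUtility t (θ.perClick i) (P.deviate i b' S') i ≤ M.mechUtility t (θ.perClick i) P i

end Market

/-- No advertiser bids more than the true value per click. -/
def NoOverbidding {ι S : Type*} (θ P : Profile ι S) : Prop :=
  ∀ i, P.perClick i ≤ θ.perClick i

/-- The pure Price of Anarchy under no overbidding: the supremum of the ratio of the optimal
integral welfare to the welfare of the mechanism over all true types and all pure Nash equilibria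
without overbidding. In `ℝ≥0∞`, `0 / 0 = 0` and `a / 0 = ∞` for `a > 0`. -/
noncomputable def Market.purePoA {ι S : Type*} [Fintype ι] [DecidableEq ι] [Fintype S]
    [DecidableEq S] (M : Market ι S) (t : TieBreaking ι S) : ENNReal :=
  ⨆ (θ : Profile ι S) (P : Profile ι S) (_ : ∀ i, 0 ≤ θ.perClick i) (_ : M.IsPureNash t θ P)
    (_ : NoOverbidding θ P),
    ENNReal.ofReal (M.intOpt θ) / ENNReal.ofReal (M.welfare θ (M.mechAlloc t P))

end RichAds

/-!
The proof compares the equilibrium with the deviations in which an advertiser reports only the ad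
`o` received in the integral optimum, together with the true value per click.

Let `B` be the reported value of the outcomes of `ALG_I` and `ALG_max` together and put
`γ = 2 B / W`. If the ads of bang-per-buck at least `d` demand at least half of the space, then
`d * W / 2 ≤ B` (`mul_half_le_reportedValue`): either `ALG_B` meets this demand, or it fills the
space with ads of bang-per-buck at least `d`, all but one of them in full; the exceptional one is
paid for by `ALG_max`. Hence above the rate `γ` less than half of the space is demanded, and an
advertiser who bids more than `γ` per unit of space for a single ad of space at most `W / 2` gets it
from `ALG_I` (`space_le_spaceOf_algB`, `clicks_algI_deviate`). The GSP price is an infimum over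
winning bids, so the payment is at most `γ` times the space of the ad, and the equilibrium condition
gives `v i o ≤ 2 * u i + γ * w i o` (`adValue_le_of_space_le_half`). For an ad of any size,
`ALG_max` gives `v i o ≤ 2 * u i + V`, where `V` is the reported value of its outcome
(`adValue_le_add_welfare_algMax`).

The optimum contains at most one ad that needs more than half of the space. If it contains none, the
sum over its ads is at most `2 ∑ u + γ W = 2 ∑ u + 2 B`; if it contains one, the other ads need at
most `W / 2`, and the sum is at most `2 ∑ u + V + B`. Utilities add up to at most the welfare `SW`
of the mechanism, and without overbidding `B ≤ 2 SW` and `V ≤ 2 SW`, so the optimum is at most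
`6 SW` in both cases.
-/

set_option linter.unusedSectionVars false

namespace RichAds

/-! ### Maximizers and deviations -/

theorem pickMax_mem {T : Type*} (E : Finset T) (hE : E.Nonempty) (f : T → ℝ)
    (priority : T → ℕ) : pickMax E hE f priority ∈ E :=
  (E.exists_max_image (fun a => toLex (f a, priority a)) hE).choose_spec.1

theorem le_pickMax {T : Type*} (E : Finset T) (hE : E.Nonempty) (f : T → ℝ)
    (priority : T → ℕ) {a : T} (ha : a ∈ E) : f a ≤ f (pickMax E hE f priority) := by
  have h := (E.exists_max_image (fun a => toLex (f a, priority a)) hE).choose_spec.2 a ha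
  rw [Prod.Lex.toLex_le_toLex] at h
  rcases h with h | h
  · exact h.le
  · exact h.1.le

section Deviate

variable {ι S : Type*} [DecidableEq ι]

@[simp] theorem Profile.deviate_perClick_self (P : Profile ι S) (i : ι) (b : ℝ) (T : Finset S) :
    (P.deviate i b T).perClick i = b := by simp [Profile.deviate]

@[simp] theorem Profile.deviate_ads_self (P : Profile ι S) (i : ι) (b : ℝ) (T : Finset S) :
    (P.deviate i b T).ads i = T := by simp [Profile.deviate]

theorem Profile.deviate_perClick_of_ne (P : Profile ι S) {i k : ι} (h : k ≠ i) (b : ℝ)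
    (T : Finset S) : (P.deviate i b T).perClick k = P.perClick k := by simp [Profile.deviate, h]

theorem Profile.deviate_ads_of_ne (P : Profile ι S) {i k : ι} (h : k ≠ i) (b : ℝ)
    (T : Finset S) : (P.deviate i b T).ads k = P.ads k := by simp [Profile.deviate, h]

@[simp] theorem Profile.deviate_deviate (P : Profile ι S) (i : ι) (b b' : ℝ) (T T' : Finset S) :
    (P.deviate i b T).deviate i b' T' = P.deviate i b' T' := by simp [Profile.deviate]

@[simp] theorem Profile.deviate_eq_self (P : Profile ι S) (i : ι) :
    P.deviate i (P.perClick i) (P.ads i) = P := by simp [Profile.deviate]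

end Deviate

namespace Market

variable {ι S : Type*} [Fintype ι] [Fintype S] [DecidableEq S]

/-! ### Values and welfare -/

theorem adValue_of_mem (M : Market ι S) {P : Profile ι S} {i : ι} {j : S} (hj : j ∈ P.ads i) :
    M.adValue P i j = P.perClick i * M.ctr i j := if_pos hj

theorem adValue_of_notMem (M : Market ι S) {P : Profile ι S} {i : ι} {j : S}
    (hj : j ∉ P.ads i) : M.adValue P i j = 0 := if_neg hj

theorem adValue_nonneg (M : Market ι S) {P : Profile ι S} {i : ι} (hP : 0 ≤ P.perClick i)
    (j : S) : 0 ≤ M.adValue P i j := by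
  unfold adValue
  split_ifs
  · exact mul_nonneg hP (M.ctr_nonneg i j)
  · exact le_rfl

theorem adValue_mono (M : Market ι S) {P θ : Profile ι S} {i : ι} (h0 : 0 ≤ P.perClick i)
    (hb : P.perClick i ≤ θ.perClick i) (hA : P.ads i ⊆ θ.ads i) (j : S) :
    M.adValue P i j ≤ M.adValue θ i j := by
  by_cases hj : j ∈ P.ads i
  · rw [M.adValue_of_mem hj, M.adValue_of_mem (hA hj)]
    exact mul_le_mul_of_nonneg_right hb (M.ctr_nonneg i j)
  · rw [M.adValue_of_notMem hj]
    exact M.adValue_nonneg (h0.trans hb) j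

theorem welfare_nonneg (M : Market ι S) {P : Profile ι S} (hP : ∀ i, 0 ≤ P.perClick i)
    {x : Allocation ι S} (hx : ∀ i j, 0 ≤ x i j) : 0 ≤ M.welfare P x :=
  Finset.sum_nonneg fun i _ => Finset.sum_nonneg fun j _ =>
    mul_nonneg (hx i j) (M.adValue_nonneg (hP i) j)

theorem welfare_mono (M : Market ι S) {P θ : Profile ι S} (h0 : ∀ i, 0 ≤ P.perClick i)
    (hb : NoOverbidding θ P) (hA : ∀ i, P.ads i ⊆ θ.ads i)
    {x : Allocation ι S} (hx : ∀ i j, 0 ≤ x i j) : M.welfare P x ≤ M.welfare θ x :=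
  Finset.sum_le_sum fun i _ => Finset.sum_le_sum fun j _ =>
    mul_le_mul_of_nonneg_left (M.adValue_mono (h0 i) (hb i) (hA i) j) (hx i j)

variable [DecidableEq ι]

/-! ### Invariants of the space allocation algorithm -/

theorem mem_initialStage_avail (M : Market ι S) (P : Profile ι S) (a : ι × S) :
    a ∈ (M.initialStage P).avail ↔ a.2 ∈ P.ads a.1 := by simp [initialStage]

@[simp] theorem spaceOf_initialStage (M : Market ι S) (P : Profile ι S) (i : ι) :
    M.spaceOf (M.initialStage P).alloc i = 0 := by simp [initialStage, spaceOf]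

theorem spaceOf_update_self (M : Market ι S) (x : Allocation ι S) (i : ι) (j : S) (c : ℝ) :
    M.spaceOf (Function.update x i (Pi.single j c)) i = M.space i j * c := by
  simp [spaceOf, Pi.single_apply]

theorem spaceOf_update_of_ne (M : Market ι S) (x : Allocation ι S) {i k : ι} (h : k ≠ i)
    (y : S → ℝ) : M.spaceOf (Function.update x i y) k = M.spaceOf x k := by
  simp [spaceOf, h]

theorem mem_processAd_avail (M : Market ι S) (s : Stage ι S) (i : ι) (j : S) (a : ι × S) :
    a ∈ (M.processAd s i j).avail ↔
      a ∈ s.avail ∧ ¬ (a.1 = i ∧ M.space i a.2 ≤ M.space i j) := by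
  unfold processAd
  dsimp only
  split_ifs <;> simp

theorem spaceOf_processAd_of_ne (M : Market ι S) (s : Stage ι S) {i k : ι} (h : k ≠ i) (j : S) :
    M.spaceOf (M.processAd s i j).alloc k = M.spaceOf s.alloc k := by
  unfold processAd
  dsimp only
  split_ifs <;> exact M.spaceOf_update_of_ne _ h _

/-- The processed ad gets all the space it asks for, or all the space that is left. -/
theorem spaceOf_processAd_self (M : Market ι S) (s : Stage ι S) (i : ι) (j : S) :
    M.spaceOf (M.processAd s i j).alloc i
      = min (M.space i j) (M.spaceOf s.alloc i + s.rem) := by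
  unfold processAd
  dsimp only
  split_ifs with h
  · simp only [spaceOf_update_self, mul_one]
    rw [min_eq_left (by linarith)]
  · simp only [spaceOf_update_self]
    rw [mul_div_cancel₀ _ (M.space_pos i j).ne', min_eq_right (by linarith)]

theorem processAd_rem (M : Market ι S) (s : Stage ι S) (i : ι) (j : S) :
    (M.processAd s i j).rem = s.rem + M.spaceOf s.alloc i
      - M.spaceOf (M.processAd s i j).alloc i := by
  rw [spaceOf_processAd_self]
  unfold processAd
  dsimp only
  split_ifs with h
  · rw [min_eq_left (by linarith)]; ring
  · rw [min_eq_right (by linarith)]; ring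

/-- A property of stages that holds initially and is preserved whenever an available ad of maximum
bang-per-buck is processed while there is space left holds for the outcome of `ALG_B`. -/
theorem algB_induction (M : Market ι S) (P : Profile ι S) (priority : ι × S → ℕ)
    (I : Stage ι S → Prop) (h0 : I (M.initialStage P))
    (hstep : ∀ s i j, I s → s.rem ≠ 0 → (i, j) ∈ s.avail →
      (∀ a ∈ s.avail, M.bangPerBuck P a ≤ M.bangPerBuck P (i, j)) → I (M.processAd s i j)) :
    I (M.algB P priority) := by
  have hn : ∀ s, I s → I (M.nextStage P priority s) := by
    intro s hs
    unfold nextStage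
    split_ifs with h
    · exact hstep s _ _ hs h.1 (pickMax_mem s.avail h.2 _ _)
        (fun a ha => le_pickMax s.avail h.2 _ _ ha)
    · exact hs
  have hit : ∀ n : ℕ, I ((M.nextStage P priority)^[n] (M.initialStage P)) := by
    intro n
    induction n with
    | zero => exact h0
    | succ n ih => rw [Function.iterate_succ_apply']; exact hn _ ih
  exact hit _

/-- Bookkeeping facts that hold at every stage: the space is split between the advertisers and the
remainder, and the available ads are reported ads needing at least the space already held. -/
structure Consistent (M : Market ι S) (P : Profile ι S) (s : Stage ι S) : Prop where
  total : ∑ k, M.spaceOf s.alloc k + s.rem = M.W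
  rem_nonneg : 0 ≤ s.rem
  mem_ads : ∀ a ∈ s.avail, a.2 ∈ P.ads a.1
  held_le : ∀ a ∈ s.avail, M.spaceOf s.alloc a.1 ≤ M.space a.1 a.2

theorem consistent_initialStage (M : Market ι S) (P : Profile ι S) :
    M.Consistent P (M.initialStage P) where
  total := by simp; rfl
  rem_nonneg := M.W_pos.le
  mem_ads a ha := (M.mem_initialStage_avail P a).1 ha
  held_le a _ := by simpa using (M.space_pos a.1 a.2).le

theorem Consistent.processAd {M : Market ι S} {P : Profile ι S} {s : Stage ι S}
    (hs : M.Consistent P s) {i : ι} (j : S) : M.Consistent P (M.processAd s i j) where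
  total := by
    have h := hs.total
    rw [← Finset.add_sum_erase _ _ (Finset.mem_univ i)] at h ⊢
    rw [Finset.sum_congr rfl fun k hk => M.spaceOf_processAd_of_ne s (Finset.ne_of_mem_erase hk) j,
      processAd_rem]
    linarith
  rem_nonneg := by
    rw [processAd_rem, spaceOf_processAd_self]
    linarith [min_le_right (M.space i j) (M.spaceOf s.alloc i + s.rem)]
  mem_ads a ha := hs.mem_ads a ((M.mem_processAd_avail s i j a).1 ha).1
  held_le a ha := by
    rw [mem_processAd_avail] at ha
    obtain ⟨k, l⟩ := a
    by_cases hk : k = i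
    · subst hk
      have : ¬ M.space k l ≤ M.space k j := fun h => ha.2 ⟨rfl, h⟩
      rw [spaceOf_processAd_self]
      linarith [min_le_left (M.space k j) (M.spaceOf s.alloc k + s.rem)]
    · dsimp only
      rw [M.spaceOf_processAd_of_ne s hk]
      exact hs.held_le (k, l) ha.1

/-- Processing an available ad never takes space away from an advertiser. -/
theorem Consistent.spaceOf_le_processAd {M : Market ι S} {P : Profile ι S} {s : Stage ι S}
    (hs : M.Consistent P s) {i : ι} {j : S} (hij : (i, j) ∈ s.avail) (k : ι) :
    M.spaceOf s.alloc k ≤ M.spaceOf (M.processAd s i j).alloc k := by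
  by_cases hk : k = i
  · subst hk
    rw [spaceOf_processAd_self]
    exact le_min (hs.held_le _ hij) (by linarith [hs.rem_nonneg])
  · rw [M.spaceOf_processAd_of_ne s hk]

/-! ### Demand at a bang-per-buck threshold -/

/-- The space that advertiser `k` asks for at threshold `d`: the largest space of a reported ad of
bang-per-buck at least `d`, and zero if there is no such ad. -/
noncomputable def demand (M : Market ι S) (P : Profile ι S) (d : ℝ) (k : ι) : ℝ :=
  (insert 0 (((P.ads k).filter fun j => d ≤ M.bangPerBuck P (k, j)).image (M.space k))).max'
    (Finset.insert_nonempty _ _)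

theorem demand_nonneg (M : Market ι S) (P : Profile ι S) (d : ℝ) (k : ι) :
    0 ≤ M.demand P d k := Finset.le_max' _ _ (Finset.mem_insert_self _ _)

theorem space_le_demand (M : Market ι S) {P : Profile ι S} {d : ℝ} {k : ι} {j : S}
    (hj : j ∈ P.ads k) (hd : d ≤ M.bangPerBuck P (k, j)) : M.space k j ≤ M.demand P d k :=
  Finset.le_max' _ _ (Finset.mem_insert_of_mem (Finset.mem_image_of_mem _
    (Finset.mem_filter.2 ⟨hj, hd⟩)))

theorem demand_eq_zero_or (M : Market ι S) (P : Profile ι S) (d : ℝ) (k : ι) :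
    M.demand P d k = 0 ∨
      ∃ j ∈ P.ads k, d ≤ M.bangPerBuck P (k, j) ∧ M.demand P d k = M.space k j := by
  have h := Finset.max'_mem
    (insert 0 (((P.ads k).filter fun j => d ≤ M.bangPerBuck P (k, j)).image (M.space k)))
    (Finset.insert_nonempty _ _)
  rw [Finset.mem_insert, Finset.mem_image] at h
  rcases h with h | ⟨j, hj, h⟩
  · exact Or.inl h
  · rw [Finset.mem_filter] at hj
    exact Or.inr ⟨j, hj.1, hj.2, h.symm⟩

/-- An advertiser who reports the single ad `o` gets all the space of `o`, provided that this space
and what the others demand at the bang-per-buck of `o` fit together into the total space. -/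
theorem space_le_spaceOf_algB (M : Market ι S) (P : Profile ι S) (priority : ι × S → ℕ)
    {i : ι} {o : S} (hi : P.ads i = {o})
    (hfit : ∑ k ∈ Finset.univ.erase i, M.demand P (M.bangPerBuck P (i, o)) k + M.space i o
      ≤ M.W) :
    M.space i o ≤ M.spaceOf (M.algB P priority).alloc i := by
  -- As long as `o` is unprocessed, only ads of at least its bang-per-buck have been processed, so
  -- the others hold at most their demand and `o` still fits; in particular the loop goes on.
  have key : ∀ s : Stage ι S, M.Consistent P s →
      (∀ k ≠ i, M.spaceOf s.alloc k ≤ M.demand P (M.bangPerBuck P (i, o)) k) →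
      M.spaceOf s.alloc i = 0 → M.space i o ≤ s.rem := by
    intro s hs hk h0
    have h := hs.total
    rw [← Finset.add_sum_erase _ _ (Finset.mem_univ i), h0] at h
    have := Finset.sum_le_sum fun k (hk' : k ∈ Finset.univ.erase i) =>
      hk k (Finset.ne_of_mem_erase hk')
    linarith
  have hinv := M.algB_induction P priority
    (fun s => M.Consistent P s ∧
      (M.space i o ≤ M.spaceOf s.alloc i ∨
        ((i, o) ∈ s.avail ∧ M.spaceOf s.alloc i = 0 ∧
          ∀ k ≠ i, M.spaceOf s.alloc k ≤ M.demand P (M.bangPerBuck P (i, o)) k)))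
    ⟨M.consistent_initialStage P, Or.inr ⟨by simp [mem_initialStage_avail, hi], by simp,
      fun k _ => by simpa using M.demand_nonneg P _ k⟩⟩ ?_
  · rcases hinv with ⟨hc, h | ⟨hav, h0, hk⟩⟩
    · exact h
    · refine absurd ⟨?_, ⟨_, hav⟩⟩ (M.algB_halted P priority)
      exact ((M.space_pos i o).trans_le (key _ hc hk h0)).ne'
  · rintro s k l ⟨hc, hs⟩ - hkl hmax
    refine ⟨hc.processAd l, ?_⟩
    rcases hs with h | ⟨hav, h0, hk⟩
    · exact Or.inl (h.trans (hc.spaceOf_le_processAd hkl i))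
    · by_cases hki : k = i
      · subst hki
        have hl : l = o := by simpa [hi] using hc.mem_ads _ hkl
        subst hl
        left
        rw [spaceOf_processAd_self, h0, zero_add]
        exact le_min le_rfl (key s hc hk h0)
      · right
        refine ⟨?_, ?_, ?_⟩
        · rw [mem_processAd_avail]
          exact ⟨hav, fun h => hki h.1.symm⟩
        · rw [M.spaceOf_processAd_of_ne s (Ne.symm hki), h0]
        · intro m hm
          by_cases hmk : m = k
          · subst hmk
            rw [spaceOf_processAd_self]
            exact (min_le_left _ _).trans (M.space_le_demand (hc.mem_ads _ hkl) (hmax _ hav))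
          · rw [M.spaceOf_processAd_of_ne s hmk]
            exact hk m hm

/-- Advertiser `k` holds nothing, or a whole reported ad of bang-per-buck at least `d`. -/
def HoldsWhole (M : Market ι S) (P : Profile ι S) (d : ℝ) (x : Allocation ι S) (k : ι) : Prop :=
  M.spaceOf x k = 0 ∨ ∃ j ∈ P.ads k, d ≤ M.bangPerBuck P (k, j) ∧ M.spaceOf x k = M.space k j

/-- Outcome of `ALG_B` relative to a threshold `d`. Either every advertiser holds at least the space
demanded at `d`, or the space is used up by ads of bang-per-buck at least `d`, all of which, except
perhaps that of one advertiser `k₀`, are allocated in full. -/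
theorem algB_threshold (M : Market ι S) (P : Profile ι S) (priority : ι × S → ℕ) (d : ℝ) :
    (∀ k, M.demand P d k ≤ M.spaceOf (M.algB P priority).alloc k) ∨
    (∑ k, M.spaceOf (M.algB P priority).alloc k = M.W ∧
      ((∀ k, M.HoldsWhole P d (M.algB P priority).alloc k) ∨
        ∃ k₀, (∀ k ≠ k₀, M.HoldsWhole P d (M.algB P priority).alloc k) ∧
          ∃ j ∈ P.ads k₀, d ≤ M.bangPerBuck P (k₀, j) ∧
            M.spaceOf (M.algB P priority).alloc k₀ ≤ M.space k₀ j)) := by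
  -- As long as every high-density ad is available or covered by the space held, running out of
  -- available high-density ads means that the demand at `d` is met.
  have key : ∀ s : Stage ι S, (∀ k, M.HoldsWhole P d s.alloc k) →
      (∀ k, ∀ j ∈ P.ads k, d ≤ M.bangPerBuck P (k, j) →
        (k, j) ∈ s.avail ∨ M.space k j ≤ M.spaceOf s.alloc k) →
      (∀ a ∈ s.avail, M.bangPerBuck P a < d) →
      ∀ k, M.demand P d k ≤ M.spaceOf s.alloc k := by
    intro s hw hcov hlow k
    rcases M.demand_eq_zero_or P d k with h | ⟨j, hj, hd, h⟩
    · rw [h]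
      rcases hw k with h' | ⟨j, -, -, h'⟩
      · exact h'.ge
      · exact h' ▸ (M.space_pos k j).le
    · rw [h]
      exact (hcov k j hj hd).resolve_left fun hav => absurd hd (hlow _ hav).not_ge
  have hinv := M.algB_induction P priority
    (fun s => M.Consistent P s ∧
      (((∀ k, M.HoldsWhole P d s.alloc k) ∧ ∀ k, ∀ j ∈ P.ads k, d ≤ M.bangPerBuck P (k, j) →
          (k, j) ∈ s.avail ∨ M.space k j ≤ M.spaceOf s.alloc k) ∨
        (∀ k, M.demand P d k ≤ M.spaceOf s.alloc k) ∨
        (s.rem = 0 ∧ ∃ k₀, (∀ k ≠ k₀, M.HoldsWhole P d s.alloc k) ∧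
          ∃ j ∈ P.ads k₀, d ≤ M.bangPerBuck P (k₀, j) ∧
            M.spaceOf s.alloc k₀ ≤ M.space k₀ j)))
    ⟨M.consistent_initialStage P, Or.inl ⟨fun k => Or.inl (by simp),
      fun k j hj _ => Or.inl ((M.mem_initialStage_avail P (k, j)).2 hj)⟩⟩ ?_
  · obtain ⟨hc, ⟨hw, hcov⟩ | h | ⟨h0, h⟩⟩ := hinv
    · by_cases h0 : (M.algB P priority).rem = 0
      · have := hc.total
        rw [h0, add_zero] at this
        exact Or.inr ⟨this, Or.inl hw⟩
      · refine Or.inl (key _ hw hcov fun a ha => ?_)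
        exact absurd ⟨h0, ⟨a, ha⟩⟩ (M.algB_halted P priority)
    · exact Or.inl h
    · have := hc.total
      rw [h0, add_zero] at this
      exact Or.inr ⟨this, Or.inr h⟩
  · rintro s i j ⟨hc, hs⟩ hrem hij hmax
    refine ⟨hc.processAd j, ?_⟩
    rcases hs with ⟨hw, hcov⟩ | h | ⟨h0, -⟩
    · by_cases hd : d ≤ M.bangPerBuck P (i, j)
      · have hw' : ∀ k ≠ i, M.HoldsWhole P d (M.processAd s i j).alloc k := by
          intro k hk
          unfold HoldsWhole
          rw [M.spaceOf_processAd_of_ne s hk]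
          exact hw k
        by_cases hfull : M.space i j ≤ M.spaceOf s.alloc i + s.rem
        · have hi : M.spaceOf (M.processAd s i j).alloc i = M.space i j := by
            rw [spaceOf_processAd_self, min_eq_left hfull]
          left
          refine ⟨fun k => ?_, fun k l hl hdl => ?_⟩
          · by_cases hk : k = i
            · subst hk
              exact Or.inr ⟨j, hc.mem_ads _ hij, hd, hi⟩
            · exact hw' k hk
          · rcases hcov k l hl hdl with hav | hle
            · rw [mem_processAd_avail]
              by_cases hrm : k = i ∧ M.space i l ≤ M.space i j
              · obtain ⟨rfl, hle⟩ := hrm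
                exact Or.inr (hi ▸ hle)
              · exact Or.inl ⟨hav, hrm⟩
            · exact Or.inr (hle.trans (hc.spaceOf_le_processAd hij k))
        · right; right
          have hi : M.spaceOf (M.processAd s i j).alloc i = M.spaceOf s.alloc i + s.rem := by
            rw [spaceOf_processAd_self, min_eq_right (not_le.1 hfull).le]
          refine ⟨by rw [processAd_rem, hi]; ring, i, hw', j, hc.mem_ads _ hij, hd, ?_⟩
          rw [hi]
          exact (not_le.1 hfull).le
      · exact Or.inr (Or.inl fun k =>
          (key s hw hcov (fun a ha => (hmax a ha).trans_lt (not_le.1 hd)) k).trans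
            (hc.spaceOf_le_processAd hij k))
    · exact Or.inr (Or.inl fun k => (h k).trans (hc.spaceOf_le_processAd hij k))
    · exact absurd h0 hrem

/-! ### The integral rules cover the threshold value -/

theorem algI_nonneg (M : Market ι S) (t : TieBreaking ι S) (P : Profile ι S) (i : ι) (j : S) :
    0 ≤ M.algI t P i j := by
  unfold algI
  split_ifs
  · rw [Pi.single_apply]
    split_ifs <;> norm_num
  · exact le_rfl

theorem algMax_nonneg (M : Market ι S) (t : TieBreaking ι S) (P : Profile ι S) (i : ι) (j : S) :
    0 ≤ M.algMax t P i j := by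
  unfold algMax
  dsimp only
  split_ifs
  · have h : (0 : Allocation ι S) ≤ Pi.single (M := fun _ : ι => S → ℝ)
        (pickMax _ ‹_› (fun a => M.adValue P a.1 a.2) (t.maxValue P)).1
        (Pi.single (pickMax _ ‹_› (fun a => M.adValue P a.1 a.2) (t.maxValue P)).2 (1 : ℝ)) :=
      Pi.single_nonneg.2 (Pi.single_nonneg.2 zero_le_one)
    exact h i j
  · exact le_rfl

/-- `ALG_I` gives `k` at least the reported value of every reported ad that fits. -/
theorem adValue_le_sum_algI (M : Market ι S) (t : TieBreaking ι S) (P : Profile ι S) {k : ι}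
    {j : S} (hj : j ∈ P.ads k)
    (hfit : M.space k j ≤ M.spaceOf (M.algB P (t.order P)).alloc k) :
    M.adValue P k j ≤ ∑ l, M.algI t P k l * M.adValue P k l := by
  have hmem : j ∈ (P.ads k).filter
      (fun j => M.space k j ≤ M.spaceOf (M.algB P (t.order P)).alloc k) :=
    Finset.mem_filter.2 ⟨hj, hfit⟩
  unfold algI
  rw [dif_pos ⟨j, hmem⟩]
  simp only [Pi.single_apply, ite_mul, one_mul, zero_mul, Finset.sum_ite_eq', Finset.mem_univ,
    if_true]
  exact le_pickMax _ _ (M.adValue P k) _ hmem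

/-- `ALG_max` realizes at least the reported value of every reported ad. -/
theorem adValue_le_welfare_algMax (M : Market ι S) (t : TieBreaking ι S) (P : Profile ι S) {k : ι}
    {j : S} (hj : j ∈ P.ads k) : M.adValue P k j ≤ M.welfare P (M.algMax t P) := by
  have hmem : (k, j) ∈ Finset.univ.filter (fun a : ι × S => a.2 ∈ P.ads a.1) := by simpa using hj
  unfold welfare algMax
  dsimp only
  rw [dif_pos ⟨_, hmem⟩]
  refine (le_pickMax _ ⟨_, hmem⟩ (fun a => M.adValue P a.1 a.2) (t.maxValue P) hmem).trans_eq ?_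
  set a := pickMax _ ⟨_, hmem⟩ (fun a => M.adValue P a.1 a.2) (t.maxValue P)
  rw [Finset.sum_eq_single a.1 (fun i _ hi => by simp [hi]) (by simp),
    Finset.sum_eq_single a.2 (fun i _ hi => by simp [hi]) (by simp)]
  simp

/-- The welfare, in terms of the reports, of `ALG_I` and `ALG_max` together. -/
noncomputable def reportedValue (M : Market ι S) (t : TieBreaking ι S) (P : Profile ι S) : ℝ :=
  M.welfare P (M.algI t P) + M.welfare P (M.algMax t P)

theorem reportedValue_nonneg (M : Market ι S) (t : TieBreaking ι S) {P : Profile ι S}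
    (hP : ∀ k, 0 ≤ P.perClick k) : 0 ≤ M.reportedValue t P :=
  add_nonneg (M.welfare_nonneg hP (M.algI_nonneg t P)) (M.welfare_nonneg hP (M.algMax_nonneg t P))

theorem mul_space_le_adValue (M : Market ι S) {P : Profile ι S} {d : ℝ} {k : ι} {j : S}
    (h : d ≤ M.bangPerBuck P (k, j)) : d * M.space k j ≤ M.adValue P k j :=
  (le_div_iff₀ (M.space_pos k j)).1 h

/-- If at least half of the space is demanded at bang-per-buck `d`, then `ALG_I` and `ALG_max`
together are worth at least half of the space at the rate `d`. -/
theorem mul_half_le_reportedValue (M : Market ι S) (t : TieBreaking ι S) {P : Profile ι S}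
    (hP : ∀ k, 0 ≤ P.perClick k) {d : ℝ} (hd : 0 ≤ d) (hD : M.W / 2 ≤ ∑ k, M.demand P d k) :
    d * (M.W / 2) ≤ M.reportedValue t P := by
  have hI0 : ∀ k, 0 ≤ ∑ l, M.algI t P k l * M.adValue P k l := fun k =>
    Finset.sum_nonneg fun l _ => mul_nonneg (M.algI_nonneg t P k l) (M.adValue_nonneg (hP k) l)
  have hmax := M.welfare_nonneg hP (M.algMax_nonneg t P)
  have hdW : d * (M.W / 2) ≤ d * M.W := by
    have := mul_nonneg hd M.W_pos.le
    linarith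
  have hwhole : ∀ k, M.HoldsWhole P d (M.algB P (t.order P)).alloc k →
      d * M.spaceOf (M.algB P (t.order P)).alloc k ≤ ∑ l, M.algI t P k l * M.adValue P k l := by
    rintro k (h | ⟨j, hj, hdj, h⟩)
    · rw [h, mul_zero]; exact hI0 k
    · rw [h]
      exact (M.mul_space_le_adValue hdj).trans (M.adValue_le_sum_algI t P hj h.ge)
  unfold reportedValue
  -- A partially allocated ad of `k₀` is worth at least the rate `d` for the space held by `k₀`, and
  -- `ALG_max` is worth at least as much as that ad.
  rcases M.algB_threshold P (t.order P) d with h | ⟨hW, h | ⟨k₀, h, j, hj, hdj, hle⟩⟩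
  · have : d * ∑ k, M.demand P d k ≤ M.welfare P (M.algI t P) := by
      rw [Finset.mul_sum]
      refine Finset.sum_le_sum fun k _ => ?_
      rcases M.demand_eq_zero_or P d k with h0 | ⟨j, hj, hdj, hkj⟩
      · rw [h0, mul_zero]; exact hI0 k
      · rw [hkj]
        exact (M.mul_space_le_adValue hdj).trans (M.adValue_le_sum_algI t P hj (hkj ▸ h k))
    linarith [mul_le_mul_of_nonneg_left hD hd]
  · have : d * M.W ≤ M.welfare P (M.algI t P) := by
      rw [← hW, Finset.mul_sum]
      exact Finset.sum_le_sum fun k _ => hwhole k (h k)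
    linarith
  · have h1 : d * M.spaceOf (M.algB P (t.order P)).alloc k₀ ≤ M.welfare P (M.algMax t P) :=
      ((mul_le_mul_of_nonneg_left hle hd).trans (M.mul_space_le_adValue hdj)).trans
        (M.adValue_le_welfare_algMax t P hj)
    have h2 : ∑ k ∈ Finset.univ.erase k₀, d * M.spaceOf (M.algB P (t.order P)).alloc k
        ≤ M.welfare P (M.algI t P) :=
      (Finset.sum_le_sum fun k hk => hwhole k (h k (Finset.ne_of_mem_erase hk))).trans
        (Finset.sum_le_sum_of_subset_of_nonneg (Finset.erase_subset _ _) fun k _ _ => hI0 k)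
    have h3 : d * M.W = ∑ k, d * M.spaceOf (M.algB P (t.order P)).alloc k := by
      rw [← hW, Finset.mul_sum]
    rw [← Finset.add_sum_erase _ _ (Finset.mem_univ k₀)] at h3
    linarith

/-! ### Prices and utilities -/

theorem gspPrice_nonneg (M : Market ι S) (rule : Profile ι S → Allocation ι S)
    (P : Profile ι S) (i : ι) : 0 ≤ M.gspPrice rule P i :=
  Real.sInf_nonneg fun _ h => h.1

theorem gspPrice_le_of_clicks_eq (M : Market ι S) (rule : Profile ι S → Allocation ι S)
    (P : Profile ι S) (i : ι) {b : ℝ} (hb : 0 ≤ b)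
    (h : M.clicks rule (P.deviate i b (P.ads i)) i = M.clicks rule P i) :
    M.gspPrice rule P i ≤ b :=
  csInf_le ⟨0, fun _ h => h.1⟩ ⟨hb, h⟩

theorem clicks_nonneg (M : Market ι S) {rule : Profile ι S → Allocation ι S}
    (hr : ∀ P i j, 0 ≤ rule P i j) (P : Profile ι S) (i : ι) : 0 ≤ M.clicks rule P i :=
  Finset.sum_nonneg fun j _ => mul_nonneg (hr P i j) (M.ctr_nonneg i j)

theorem gspUtility_nonneg (M : Market ι S) {rule : Profile ι S → Allocation ι S}
    (hr : ∀ P i j, 0 ≤ rule P i j) {P : Profile ι S} {i : ι} {v : ℝ} (h0 : 0 ≤ P.perClick i)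
    (hv : P.perClick i ≤ v) : 0 ≤ M.gspUtility rule v P i := by
  have h := M.gspPrice_le_of_clicks_eq rule P i h0 (by rw [P.deviate_eq_self])
  have := mul_nonneg (M.clicks_nonneg hr P i) (sub_nonneg.2 (h.trans hv))
  unfold gspUtility
  linarith

/-- The utility of an advertiser is at most the advertiser's share of the true welfare. -/
theorem gspUtility_le (M : Market ι S) {rule : Profile ι S → Allocation ι S}
    (hr : ∀ P i j, 0 ≤ rule P i j) {θ P : Profile ι S} {i : ι} (hv : 0 ≤ θ.perClick i)
    (hA : P.ads i ⊆ θ.ads i) :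
    M.gspUtility rule (θ.perClick i) P i ≤ ∑ j, rule P i j * M.adValue θ i j := by
  have h1 : θ.perClick i * M.clicks rule P i = ∑ j ∈ P.ads i, rule P i j * M.adValue θ i j := by
    unfold clicks
    rw [Finset.mul_sum]
    refine Finset.sum_congr rfl fun j hj => ?_
    rw [M.adValue_of_mem (hA hj)]
    ring
  have h2 : ∑ j ∈ P.ads i, rule P i j * M.adValue θ i j ≤ ∑ j, rule P i j * M.adValue θ i j :=
    Finset.sum_le_sum_of_subset_of_nonneg (Finset.subset_univ _) fun j _ _ =>
      mul_nonneg (hr P i j) (M.adValue_nonneg hv j)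
  have h3 := mul_nonneg (M.clicks_nonneg hr P i) (M.gspPrice_nonneg rule P i)
  unfold gspUtility
  linarith

/-- If reporting only the ad `o` wins all its clicks with every bid worth more than `c` on `o`, then
reporting it truthfully leaves at least the value of `o` minus `c`. -/
theorem sub_le_gspUtility_deviate (M : Market ι S) {rule : Profile ι S → Allocation ι S}
    (hr : ∀ P i j, 0 ≤ rule P i j) (P : Profile ι S) {i : ι} {o : S} {v c : ℝ} (hv : 0 ≤ v)
    (hc : 0 ≤ c)
    (hwin : ∀ b, c < b * M.ctr i o → M.clicks rule (P.deviate i b {o}) i = M.ctr i o) :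
    v * M.ctr i o - c ≤ M.gspUtility rule v (P.deviate i v {o}) i := by
  by_cases hvc : c < v * M.ctr i o
  · have hα : 0 < M.ctr i o := by
      refine (M.ctr_nonneg i o).lt_of_ne fun h => ?_
      rw [← h, mul_zero] at hvc
      exact absurd hvc hc.not_gt
    have hprice : M.gspPrice rule (P.deviate i v {o}) i ≤ c / M.ctr i o := by
      refine le_of_forall_gt_imp_ge_of_dense fun b hb => ?_
      rw [div_lt_iff₀ hα] at hb
      refine M.gspPrice_le_of_clicks_eq _ _ _ ?_ ?_
      · exact le_of_mul_le_mul_right (by linarith) hα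
      · rw [Profile.deviate_ads_self, Profile.deviate_deviate, hwin b hb, hwin v hvc]
    rw [le_div_iff₀ hα] at hprice
    unfold gspUtility
    rw [hwin v hvc]
    linarith
  · have := M.gspUtility_nonneg hr (P := P.deviate i v {o}) (i := i) (v := v) (by simpa) (by simp)
    linarith [not_lt.1 hvc]

/-! ### Deviations to a single ad -/

theorem bangPerBuck_deviate_of_ne (M : Market ι S) (P : Profile ι S) {i k : ι} (hk : k ≠ i)
    (b : ℝ) (T : Finset S) (j : S) :
    M.bangPerBuck (P.deviate i b T) (k, j) = M.bangPerBuck P (k, j) := by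
  simp [bangPerBuck, adValue, P.deviate_perClick_of_ne hk, P.deviate_ads_of_ne hk]

theorem demand_deviate_of_ne (M : Market ι S) (P : Profile ι S) {i k : ι} (hk : k ≠ i)
    (b : ℝ) (T : Finset S) (d : ℝ) : M.demand (P.deviate i b T) d k = M.demand P d k := by
  simp [demand, M.bangPerBuck_deviate_of_ne P hk, P.deviate_ads_of_ne hk]

/-- Under `ALG_I`, an ad `o` that takes at most half of the space is won by bidding for it alone
at a rate per unit of space above twice the reported value per unit of total space: at such a rate
the others demand less than half of the space. -/
theorem clicks_algI_deviate (M : Market ι S) (t : TieBreaking ι S) {P : Profile ι S}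
    (hP : ∀ k, 0 ≤ P.perClick k) {i : ι} {o : S} (ho : M.space i o ≤ M.W / 2) {b : ℝ}
    (hb : 2 * M.reportedValue t P / M.W * M.space i o < b * M.ctr i o) :
    M.clicks (M.algI t) (P.deviate i b {o}) i = M.ctr i o := by
  set Q := P.deviate i b {o} with hQ
  have hads : Q.ads i = {o} := by simp [hQ]
  have hd : 2 * M.reportedValue t P / M.W < M.bangPerBuck Q (i, o) := by
    unfold bangPerBuck
    rw [lt_div_iff₀ (M.space_pos i o), M.adValue_of_mem (by simp [hads])]
    simpa [hQ] using hb
  set d := M.bangPerBuck Q (i, o) with hd_def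
  have hγ : 0 ≤ 2 * M.reportedValue t P / M.W :=
    div_nonneg (mul_nonneg zero_le_two (M.reportedValue_nonneg t hP)) M.W_pos.le
  have hD : ∑ k, M.demand P d k < M.W / 2 := by
    by_contra h
    have h1 := M.mul_half_le_reportedValue t hP (hγ.trans hd.le) (not_lt.1 h)
    rw [div_lt_iff₀ M.W_pos] at hd
    linarith
  have hD' : ∑ k ∈ Finset.univ.erase i, M.demand Q d k ≤ ∑ k, M.demand P d k := by
    rw [Finset.sum_congr rfl fun k hk =>
      M.demand_deviate_of_ne P (Finset.ne_of_mem_erase hk) b {o} d]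
    exact Finset.sum_le_sum_of_subset_of_nonneg (Finset.erase_subset _ _)
      fun k _ _ => M.demand_nonneg P d k
  have hfit := M.space_le_spaceOf_algB Q (t.order Q) hads (by linarith)
  have hfilter : (Q.ads i).filter
      (fun j => M.space i j ≤ M.spaceOf (M.algB Q (t.order Q)).alloc i) = {o} := by
    rw [hads, Finset.filter_singleton, if_pos hfit]
  have hpick : ∀ h, pickMax ((Q.ads i).filter
      (fun j => M.space i j ≤ M.spaceOf (M.algB Q (t.order Q)).alloc i)) h (M.adValue Q i)
      (fun j => t.post Q (i, j)) = o := fun h => by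
    have := pickMax_mem _ h (M.adValue Q i) (fun j => t.post Q (i, j))
    rw [← Finset.mem_singleton, ← hfilter]
    exact this
  unfold clicks
  rw [hads, Finset.sum_singleton]
  unfold algI
  rw [dif_pos (by rw [hfilter]; exact Finset.singleton_nonempty o), hpick]
  simp

/-- Under `ALG_max`, an ad is won by bidding for it alone more than the reported value of the ad
that is allocated otherwise. -/
theorem clicks_algMax_deviate (M : Market ι S) (t : TieBreaking ι S) {P : Profile ι S} {i : ι}
    {o : S} {b : ℝ} (hb : M.welfare P (M.algMax t P) < b * M.ctr i o) :
    M.clicks (M.algMax t) (P.deviate i b {o}) i = M.ctr i o := by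
  set Q := P.deviate i b {o} with hQ
  have hads : Q.ads i = {o} := by simp [hQ]
  have hmem : (i, o) ∈ Finset.univ.filter (fun a : ι × S => a.2 ∈ Q.ads a.1) := by simp [hads]
  have hpick : pickMax _ ⟨_, hmem⟩ (fun a => M.adValue Q a.1 a.2) (t.maxValue Q) = (i, o) := by
    have h1 := pickMax_mem _ ⟨_, hmem⟩ (fun a => M.adValue Q a.1 a.2) (t.maxValue Q)
    have h2 := le_pickMax _ ⟨_, hmem⟩ (fun a => M.adValue Q a.1 a.2) (t.maxValue Q) hmem
    generalize pickMax _ ⟨_, hmem⟩ (fun a => M.adValue Q a.1 a.2) (t.maxValue Q) = a at h1 h2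
    obtain ⟨k, j⟩ := a
    simp only [Finset.mem_filter, Finset.mem_univ, true_and] at h1
    by_cases hk : k = i
    · subst hk
      rw [hads, Finset.mem_singleton] at h1
      rw [h1]
    · exfalso
      have hj : j ∈ P.ads k := by rwa [hQ, P.deviate_ads_of_ne hk] at h1
      have h3 : M.adValue Q k j = M.adValue P k j := by
        simp [adValue, hQ, P.deviate_perClick_of_ne hk, P.deviate_ads_of_ne hk]
      have h4 : M.adValue Q i o = b * M.ctr i o := by
        rw [M.adValue_of_mem (by simp [hads])]; simp [hQ]
      have h5 := M.adValue_le_welfare_algMax t P hj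
      dsimp only at h2
      linarith
  unfold clicks
  rw [hads, Finset.sum_singleton]
  unfold algMax
  dsimp only
  rw [dif_pos ⟨_, hmem⟩, hpick]
  simp

/-! ### Equilibria -/

section Equilibrium

variable {M : Market ι S} {t : TieBreaking ι S} {θ P : Profile ι S}

theorem mechUtility_nonneg (hN : M.IsPureNash t θ P) (hb : NoOverbidding θ P) (i : ι) :
    0 ≤ M.mechUtility t (θ.perClick i) P i := by
  have h1 := M.gspUtility_nonneg (M.algI_nonneg t) (hN.1 i).1 (hb i)
  have h2 := M.gspUtility_nonneg (M.algMax_nonneg t) (hN.1 i).1 (hb i)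
  unfold mechUtility
  linarith

theorem welfare_mechAlloc (M : Market ι S) (t : TieBreaking ι S) (θ P : Profile ι S) :
    M.welfare θ (M.mechAlloc t P)
      = (1 / 2) * M.welfare θ (M.algI t P) + (1 / 2) * M.welfare θ (M.algMax t P) := by
  simp only [welfare, mechAlloc, Finset.mul_sum, ← Finset.sum_add_distrib]
  exact Finset.sum_congr rfl fun i _ => Finset.sum_congr rfl fun j _ => by ring

theorem sum_mechUtility_le (hθ : ∀ i, 0 ≤ θ.perClick i) (hN : M.IsPureNash t θ P) :
    ∑ i, M.mechUtility t (θ.perClick i) P i ≤ M.welfare θ (M.mechAlloc t P) := by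
  rw [welfare_mechAlloc]
  simp only [welfare, Finset.mul_sum, ← Finset.sum_add_distrib]
  refine Finset.sum_le_sum fun i _ => ?_
  have h1 := M.gspUtility_le (M.algI_nonneg t) (hθ i) (hN.1 i).2
  have h2 := M.gspUtility_le (M.algMax_nonneg t) (hθ i) (hN.1 i).2
  unfold mechUtility
  rw [Finset.sum_add_distrib, ← Finset.mul_sum, ← Finset.mul_sum]
  linarith

/-- In equilibrium, the value of an ad that takes at most half of the space is covered by twice the
utility and a price proportional to the space. -/
theorem adValue_le_of_space_le_half (hθ : ∀ i, 0 ≤ θ.perClick i) (hN : M.IsPureNash t θ P)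
    (hb : NoOverbidding θ P) {i : ι} {o : S} (ho : M.space i o ≤ M.W / 2) :
    M.adValue θ i o ≤ 2 * M.mechUtility t (θ.perClick i) P i
      + 2 * M.reportedValue t P / M.W * M.space i o := by
  have hc : 0 ≤ 2 * M.reportedValue t P / M.W * M.space i o :=
    mul_nonneg (div_nonneg (mul_nonneg zero_le_two
      (M.reportedValue_nonneg t fun k => (hN.1 k).1)) M.W_pos.le) (M.space_pos i o).le
  by_cases hmem : o ∈ θ.ads i
  · have h1 := M.sub_le_gspUtility_deviate (M.algI_nonneg t) P (hθ i) hc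
      fun b => M.clicks_algI_deviate t (fun k => (hN.1 k).1) ho
    have h2 := M.gspUtility_nonneg (M.algMax_nonneg t) (P := P.deviate i (θ.perClick i) {o})
      (i := i) (v := θ.perClick i) (by simpa using hθ i) (by simp)
    have h3 := hN.2 i (θ.perClick i) {o} (hθ i) (by simpa using hmem)
    rw [M.adValue_of_mem hmem]
    unfold mechUtility at h3 ⊢
    linarith
  · rw [M.adValue_of_notMem hmem]
    linarith [mechUtility_nonneg hN hb i]

/-- In equilibrium, the value of any ad is covered by twice the utility and the reported value of
the outcome of `ALG_max`. -/
theorem adValue_le_add_welfare_algMax (hθ : ∀ i, 0 ≤ θ.perClick i) (hN : M.IsPureNash t θ P)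
    (hb : NoOverbidding θ P) (i : ι) (o : S) :
    M.adValue θ i o ≤ 2 * M.mechUtility t (θ.perClick i) P i
      + M.welfare P (M.algMax t P) := by
  have hc := M.welfare_nonneg (fun k => (hN.1 k).1) (M.algMax_nonneg t P)
  by_cases hmem : o ∈ θ.ads i
  · have h1 := M.sub_le_gspUtility_deviate (M.algMax_nonneg t) P (hθ i) hc
      fun b => M.clicks_algMax_deviate t (i := i) (o := o) (b := b)
    have h2 := M.gspUtility_nonneg (M.algI_nonneg t) (P := P.deviate i (θ.perClick i) {o})
      (i := i) (v := θ.perClick i) (by simpa using hθ i) (by simp)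
    have h3 := hN.2 i (θ.perClick i) {o} (hθ i) (by simpa using hmem)
    rw [M.adValue_of_mem hmem]
    unfold mechUtility at h3 ⊢
    linarith
  · rw [M.adValue_of_notMem hmem]
    linarith [mechUtility_nonneg hN hb i]

/-- The covering bounds, summed over the ads of an integral allocation. -/
theorem welfare_le_of_isIntegralFeasible (hθ : ∀ i, 0 ≤ θ.perClick i)
    (hN : M.IsPureNash t θ P) (hb : NoOverbidding θ P) {x : Allocation ι S}
    (hx : M.IsIntegralFeasible x) :
    M.welfare θ x ≤ 6 * M.welfare θ (M.mechAlloc t P) := by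
  obtain ⟨h01, hone, hW⟩ := hx
  have hx0 : ∀ i j, 0 ≤ x i j := fun i j => by rcases h01 i j with h | h <;> simp [h]
  have hP0 := fun k => (hN.1 k).1
  set u := fun i => M.mechUtility t (θ.perClick i) P i with hu
  set γ := 2 * M.reportedValue t P / M.W with hγ
  have hB0 := M.reportedValue_nonneg t hP0
  have hγ0 : 0 ≤ γ := div_nonneg (mul_nonneg zero_le_two hB0) M.W_pos.le
  have hγW : γ * M.W = 2 * M.reportedValue t P := div_mul_cancel₀ _ M.W_pos.ne'
  have hmaxθ := M.welfare_mono hP0 hb (fun k => (hN.1 k).2) (M.algMax_nonneg t P)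
  have hIθ := M.welfare_mono hP0 hb (fun k => (hN.1 k).2) (M.algI_nonneg t P)
  have hI0 := M.welfare_nonneg hθ (M.algI_nonneg t P)
  have hB : M.reportedValue t P ≤ 2 * M.welfare θ (M.mechAlloc t P) := by
    rw [welfare_mechAlloc]
    unfold reportedValue
    linarith
  have hV : M.welfare P (M.algMax t P) ≤ 2 * M.welfare θ (M.mechAlloc t P) := by
    rw [welfare_mechAlloc]
    linarith
  have hu_sum : ∑ a : ι × S, x a.1 a.2 * u a.1 ≤ M.welfare θ (M.mechAlloc t P) := by
    rw [Fintype.sum_prod_type]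
    refine le_trans (Finset.sum_le_sum fun i _ => ?_) (sum_mechUtility_le hθ hN)
    dsimp only
    rw [← Finset.sum_mul]
    exact mul_le_of_le_one_left (mechUtility_nonneg hN hb i) (hone i)
  have hWp : ∑ a : ι × S, x a.1 a.2 * M.space a.1 a.2 ≤ M.W := by
    rwa [Fintype.sum_prod_type]
  have hwel : M.welfare θ x = ∑ a : ι × S, x a.1 a.2 * M.adValue θ a.1 a.2 := by
    rw [Fintype.sum_prod_type]; rfl
  have hnn : ∀ a : ι × S, 0 ≤ x a.1 a.2 * M.space a.1 a.2 := fun a =>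
    mul_nonneg (hx0 _ _) (M.space_pos _ _).le
  have hsmall : ∀ a : ι × S, (x a.1 a.2 = 1 → M.space a.1 a.2 ≤ M.W / 2) →
      x a.1 a.2 * M.adValue θ a.1 a.2
        ≤ 2 * (x a.1 a.2 * u a.1) + γ * (x a.1 a.2 * M.space a.1 a.2) := by
    intro a ha
    rcases h01 a.1 a.2 with h | h
    · simp [h]
    · rw [h]
      linarith [adValue_le_of_space_le_half hθ hN hb (ha h)]
  rw [hwel]
  by_cases hbig : ∃ a : ι × S, x a.1 a.2 = 1 ∧ M.W / 2 < M.space a.1 a.2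
  · obtain ⟨a₀, ha₀, hbig⟩ := hbig
    rw [← Finset.add_sum_erase _ _ (Finset.mem_univ a₀)] at hu_sum hWp ⊢
    rw [ha₀, one_mul] at hu_sum hWp ⊢
    have h1 := adValue_le_add_welfare_algMax hθ hN hb a₀.1 a₀.2
    -- Next to `a₀`, less than half of the space is left, so all other ads are small.
    have h2 := Finset.sum_le_sum fun a (ha : a ∈ Finset.univ.erase a₀) => hsmall a fun hxa => by
      have := Finset.single_le_sum (fun a _ => hnn a) ha
      rw [hxa, one_mul] at this
      linarith
    rw [Finset.sum_add_distrib, ← Finset.mul_sum, ← Finset.mul_sum] at h2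
    have h3 : γ * ∑ a ∈ Finset.univ.erase a₀, x a.1 a.2 * M.space a.1 a.2 ≤ γ * (M.W / 2) :=
      mul_le_mul_of_nonneg_left (by linarith) hγ0
    have h4 : u a₀.1 = M.mechUtility t (θ.perClick a₀.1) P a₀.1 := rfl
    linarith
  · push Not at hbig
    have h2 := Finset.sum_le_sum fun a (_ : a ∈ Finset.univ) => hsmall a (hbig a)
    rw [Finset.sum_add_distrib, ← Finset.mul_sum, ← Finset.mul_sum] at h2
    have h3 := mul_le_mul_of_nonneg_left hWp hγ0
    linarith

end Equilibrium

end Market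

end RichAds

theorem mainTheorem5 {ι S : Type*} [Fintype ι] [DecidableEq ι] [Fintype S] [DecidableEq S]
    (M : RichAds.Market ι S) (t : RichAds.TieBreaking ι S) :
    M.purePoA t ≤ 6 ∧
      ∀ θ P : RichAds.Profile ι S, (∀ i, 0 ≤ θ.perClick i) →
        M.IsPureNash t θ P → RichAds.NoOverbidding θ P →
          (1 / 6) * M.intOpt θ ≤ M.welfare θ (M.mechAlloc t P) := by
  have key : ∀ θ P : RichAds.Profile ι S, (∀ i, 0 ≤ θ.perClick i) →
      M.IsPureNash t θ P → RichAds.NoOverbidding θ P →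
        M.intOpt θ ≤ 6 * M.welfare θ (M.mechAlloc t P) := by
    intro θ P hθ hN hb
    obtain ⟨x, hx, hopt⟩ := (M.isGreatest_intOpt θ).1
    rw [← hopt]
    exact RichAds.Market.welfare_le_of_isIntegralFeasible hθ hN hb hx
  refine ⟨?_, fun θ P hθ hN hb => by linarith [key θ P hθ hN hb]⟩
  unfold RichAds.Market.purePoA
  refine iSup_le fun θ => iSup_le fun P => iSup_le fun hθ => iSup_le fun hN => iSup_le fun hb => ?_
  refine ENNReal.div_le_of_le_mul ?_
  rw [← ENNReal.ofReal_ofNat 6, ← ENNReal.ofReal_mul (by norm_num)]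
  exact ENNReal.ofReal_le_ofReal (key θ P hθ hN hb)
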